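/- Let $n\ge 1$ and let $S_n$ be the group of permutations of $n$ points. Call a permutation in $S_n$ cyclic if it consists of a single cycle through all $n$ points (for $n=1$ the identity is cyclic). Let $Q^{(n)}$ be the $n!\times n!$ complex matrix with rows and columns indexed by $S_n$ such that $Q^{(n)}_{\pi,\sigma}=1$ if $\sigma\circ\pi^{-1}$ is cyclic and $Q^{(n)}_{\pi,\sigma}=0$ otherwise. Let $P^{(n)}$ be the matrix with the same index sets such that $P^{(n)}_{\pi,\sigma}=1$ if $\sigma\circ\pi$ is cyclic and $P^{(n)}_{\pi,\sigma}=0$ otherwise. Then $$\operatorname{rank} Q^{(n)}=\operatorname{rank} P^{(n)}=\binom{2n-2}{n-1}.$$ -/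

import Mathlib

/-- A permutation of `n` points is cyclic (an `n`-cycle) if it consists of a single cycle through
all the points. For `n = 1` the identity is cyclic, so that there are `(n - 1)!` cyclic
permutations for every `n ≥ 1`; `Equiv.Perm.IsCycle` would exclude this case. -/
def IsCyclicPerm {n : ℕ} (p : Equiv.Perm (Fin n)) : Prop :=
  p.IsCycleOn Set.univ

open Classical in
/-- The matrix `P` indexed by permutations: the entry at `(π, σ)` is `1` if `σ ∘ π` is cyclic
and `0` otherwise. -/
noncomputable def matrixP (n : ℕ) :
    Matrix (Equiv.Perm (Fin n)) (Equiv.Perm (Fin n)) ℂ :=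
  Matrix.of fun π σ => if IsCyclicPerm (σ * π) then 1 else 0

open Classical in
/-- The matrix `Q` indexed by permutations: the entry at `(π, σ)` is `1` if `σ ∘ π⁻¹` is cyclic
and `0` otherwise. -/
noncomputable def matrixQ (n : ℕ) :
    Matrix (Equiv.Perm (Fin n)) (Equiv.Perm (Fin n)) ℂ :=
  Matrix.of fun π σ => if IsCyclicPerm (σ * π⁻¹) then 1 else 0

open Equiv Equiv.Perm

/-! Put `d = n - 1`. The two matrices differ by permuting rows along `π ↦ π⁻¹`, so bounding `Q`
above and `P` below suffices. Upper bound: on the `d`-dimensional sum-zero representation `ρ`, `det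
(1 - ρ p)` is a nonzero constant times the cyclic indicator. Up to row scaling, `Q` thus has entries
`det (ρ π - ρ σ)`, and expanding along subsets of rows factors it through a space of dimension `∑ s,
d.choose s.card = (2 * d).choose d`. Lower bound: fix a point `o` and test `P` on vectors indexed by
pairs `(S, T)` of equal-size subsets of the other points. The resulting square matrix of size `(2 *
d).choose d` is triangular for inclusion with nonzero diagonal. -/

/-! ### Rank of matrices with entries `det (A i - B j)` -/

theorem Matrix.rank_le_finrank_of_factor {K m n W : Type*} [Field K] [Fintype n]
    [AddCommGroup W] [Module K W] [Module.Finite K W] (M : Matrix m n K)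
    (ev : m → W →ₗ[K] K) (φ : n → W) (h : ∀ i j, M i j = ev i (φ j)) :
    M.rank ≤ Module.finrank K W := by
  have hM : M.mulVecLin = (LinearMap.pi ev).comp (Fintype.linearCombination K φ) := by
    ext v i
    simp [Fintype.linearCombination_apply, Matrix.mulVec, dotProduct, h, map_sum, mul_comm]
  rw [Matrix.rank, hM, LinearMap.range_comp]
  exact (Submodule.finrank_map_le _ _).trans (Submodule.finrank_le _)

theorem sum_finset_choose_card (d : ℕ) :
    ∑ s : Finset (Fin d), d.choose s.card = (2 * d).choose d := by
  rw [← Nat.sum_range_choose_sq, ← Finset.powerset_univ,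
    Finset.sum_powerset_apply_card d.choose]
  simp [sq]

/-- The determinant as an alternating function of the rows indexed by `s`, the other rows being
those of `B`. -/
def detRowsAlternating {K : Type*} [Field K] {d : ℕ} (s : Finset (Fin d))
    (B : Matrix (Fin d) (Fin d) K) : (Fin d → K) [⋀^Fin s.card]→ₗ[K] K :=
  AlternatingMap.domDomCongr (s.orderIsoOfFin rfl).toEquiv.symm
  { (Matrix.detRowAlternating (R := K) (n := Fin d)).toMultilinearMap.domDomRestrict (· ∈ s)
      (fun i => B i) with
    map_eq_zero_of_eq' := by
      intro v i j hij hne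
      refine Matrix.det_zero_of_row_eq (i := (i : Fin d)) (j := (j : Fin d))
        (fun h => hne (Subtype.ext h)) ?_
      simp [hij] }

theorem detRowsAlternating_apply {K : Type*} [Field K] {d : ℕ} (s : Finset (Fin d))
    (A B : Matrix (Fin d) (Fin d) K) :
    detRowsAlternating s B (fun i => A (s.orderIsoOfFin rfl i)) =
      (Matrix.detRowAlternating (R := K) (n := Fin d)) (s.piecewise A B) := by
  have : (fun i => if i ∈ s then A i else B i) = s.piecewise A B := rfl
  rw [← this]
  change Matrix.det _ = Matrix.det _
  congr 1
  ext i j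
  by_cases h : i ∈ s
  · have hi : s.orderEmbOfFin rfl ((s.orderIsoOfFin rfl).symm ⟨i, h⟩) = i := by
      rw [← Finset.coe_orderIsoOfFin_apply, OrderIso.apply_symm_apply]
    simp [h, hi]
  · simp [h]

/-- Multilinearity in the rows gives one term per set `s` of rows taken from `A`. That term is
alternating in those rows, so it factors through the exterior power of degree `s.card`. -/
theorem Matrix.rank_det_sub_le {K m n : Type*} [Field K] [Fintype n] {d : ℕ}
    (A : m → Matrix (Fin d) (Fin d) K) (B : n → Matrix (Fin d) (Fin d) K) :
    (Matrix.of fun i j => (A i - B j).det).rank ≤ (2 * d).choose d := by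
  have hfin : Module.finrank K
      ((s : Finset (Fin d)) → Module.Dual K (⋀[K]^s.card (Fin d → K))) = (2 * d).choose d := by
    rw [Module.finrank_pi_fintype, ← sum_finset_choose_card]
    simp [Subspace.dual_finrank_eq, exteriorPower.finrank_eq]
  rw [← hfin]
  refine Matrix.rank_le_finrank_of_factor _
    (fun i => ∑ s : Finset (Fin d),
      (Module.Dual.eval K _ (exteriorPower.ιMulti K s.card
        (fun k => A i (s.orderIsoOfFin rfl k)))).comp (LinearMap.proj s))
    (fun j s => exteriorPower.alternatingMapLinearEquiv (detRowsAlternating s (-(B j)))) ?_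
  intro i j
  simp only [Matrix.of_apply, LinearMap.sum_apply, LinearMap.comp_apply, LinearMap.proj_apply,
    Module.Dual.eval_apply, exteriorPower.alternatingMapLinearEquiv_apply_ιMulti,
    detRowsAlternating_apply]
  rw [sub_eq_add_neg]
  exact AlternatingMap.map_add_univ _ _ _

/-- The functions on `α` whose values sum to zero. -/
def sumZero (α : Type*) [Fintype α] : Submodule ℂ (α → ℂ) :=
  LinearMap.ker (Fintype.linearCombination ℂ (fun _ : α => (1 : ℂ)))

theorem one_sub_mul_mul_of_mul_eq_one {R : Type*} [Ring R] {a b : R} (h : a * b = 1) (q : R) :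
    1 - a * q * b = a * (1 - q) * b := by
  rw [mul_sub, sub_mul, mul_one, h]

theorem Equiv.Perm.SameCycle.apply_eq_of_invariant {α β : Type*} {p : Perm α} {v : α → β}
    (h : ∀ x, v (p x) = v x) {x y : α} (hxy : p.SameCycle x y) : v x = v y := by
  have hz : ∀ x, v (p⁻¹ x) = v x := fun x => by simpa using (h (p⁻¹ x)).symm
  obtain ⟨k, rfl⟩ := hxy
  induction k using Int.induction_on with
  | zero => rfl
  | succ k ih => rw [ih, add_comm, zpow_one_add, mul_apply, h]
  | pred k ih => rw [ih, sub_eq_neg_add, zpow_add, zpow_neg_one, mul_apply, hz]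

theorem isCycleOn_univ_iff {α : Type*} {p : Perm α} :
    p.IsCycleOn Set.univ ↔ ∀ x y, p.SameCycle x y := by
  simp [IsCycleOn, Set.bijOn_univ, p.bijective]

/-! ### The sum-zero representation detects full cycles -/

section
variable {α : Type*} [Fintype α]

theorem mem_sumZero {v : α → ℂ} : v ∈ sumZero α ↔ ∑ x, v x = 0 := by
  simp [sumZero, Fintype.linearCombination_apply]

theorem finrank_sumZero [Nonempty α] :
    Module.finrank ℂ (sumZero α) = Fintype.card α - 1 := by
  classical
  have h := LinearMap.finrank_range_add_finrank_ker
    (Fintype.linearCombination ℂ (fun _ : α => (1 : ℂ)))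
  have hs : LinearMap.range (Fintype.linearCombination ℂ (fun _ : α => (1 : ℂ))) = ⊤ := by
    rw [LinearMap.range_eq_top]
    intro c
    refine ⟨Pi.single (Classical.arbitrary α) c, ?_⟩
    simp
  rw [hs, finrank_top, Module.finrank_self, Module.finrank_pi] at h
  rw [sumZero]
  omega

/-- The permutation representation on functions with sum zero. -/
def sumZeroRep : Perm α →* Module.End ℂ (sumZero α) where
  toFun p := (LinearMap.funLeft ℂ ℂ (p⁻¹ : Perm α)).restrict (fun v hv => by
    rw [mem_sumZero] at hv ⊢
    rw [← hv]
    exact Equiv.sum_comp p⁻¹ v)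
  map_one' := by ext; simp
  map_mul' p q := by ext; simp [LinearMap.funLeft_apply]

theorem sumZeroRep_apply (p : Perm α) (v : sumZero α) (x : α) :
    (sumZeroRep p v : α → ℂ) x = (v : α → ℂ) (p⁻¹ x) := rfl

/-- The kernel of `1 - sumZeroRep p` is the space of sum-zero functions constant on cycles, which is
nonzero exactly when there are several cycles. -/
theorem det_one_sub_sumZeroRep_eq_zero_iff [Nonempty α] (p : Perm α) :
    LinearMap.det (1 - sumZeroRep p) = 0 ↔ ¬ p.IsCycleOn Set.univ := by
  classical
  have hfix (v : sumZero α) : v ∈ LinearMap.ker (1 - sumZeroRep p) ↔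
      ∀ x, (v : α → ℂ) (p x) = (v : α → ℂ) x := by
    rw [LinearMap.mem_ker, LinearMap.sub_apply, sub_eq_zero, Subtype.ext_iff, funext_iff]
    simp only [Module.End.one_apply, sumZeroRep_apply]
    exact ⟨fun h x => by simpa using h (p x), fun h x => by simpa using h (p⁻¹ x)⟩
  rw [LinearMap.det_eq_zero_iff_ker_ne_bot, not_iff_not]
  constructor
  · intro hbot
    rw [isCycleOn_univ_iff]
    by_contra hne
    push Not at hne
    obtain ⟨x, y, hxy⟩ := hne
    set O : Finset α := {z | p.SameCycle x z} with hO
    -- The indicator of the cycle of `x`, centred and scaled to avoid division; at `y` it is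
    -- `-O.card ≠ 0`.
    let v : α → ℂ := fun z => (Fintype.card α : ℂ) * (if z ∈ O then 1 else 0) - O.card
    have hv : v ∈ sumZero α := by
      rw [mem_sumZero]
      simp [v, Finset.sum_sub_distrib, mul_comm]
    have hk : (⟨v, hv⟩ : sumZero α) ∈ LinearMap.ker (1 - sumZeroRep p) := by
      rw [hfix]
      intro z
      simp [v, hO, sameCycle_apply_right]
    rw [hbot, Submodule.mem_bot, Subtype.ext_iff] at hk
    have hy := congrFun hk y
    have hyO : y ∉ O := by simpa [hO] using hxy
    have hxO : x ∈ O := by simp [hO, SameCycle.refl]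
    simp [v, hyO] at hy
    rw [hy] at hxO
    simp at hxO
  · intro hp
    rw [isCycleOn_univ_iff] at hp
    rw [eq_bot_iff]
    intro v hv
    rw [hfix] at hv
    have hconst : ∀ x y, (v : α → ℂ) x = (v : α → ℂ) y :=
      fun x y => SameCycle.apply_eq_of_invariant hv (hp x y)
    rw [Submodule.mem_bot]
    ext x
    have hs := mem_sumZero.1 v.2
    rw [Finset.sum_congr rfl (fun y _ => hconst y x)] at hs
    simpa using hs

theorem isConj_of_isCycleOn_univ {p q : Perm α} (hp : p.IsCycleOn Set.univ)
    (hq : q.IsCycleOn Set.univ) : IsConj p q := by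
  classical
  rcases subsingleton_or_nontrivial α with h | h
  · rw [Subsingleton.elim p q]
  · have key : ∀ r : Perm α, r.IsCycleOn Set.univ → r.IsCycle ∧ r.support = Finset.univ := by
      intro r hr
      have hne : ∀ x, r x ≠ x := fun x => hr.apply_ne Set.nontrivial_univ (Set.mem_univ x)
      refine ⟨⟨Classical.arbitrary α, hne _, fun y _ => isCycleOn_univ_iff.1 hr _ _⟩, ?_⟩
      ext x
      simp [hne x]
    exact (key p hp).1.isConj (key q hq).1 (by rw [(key p hp).2, (key q hq).2])

open Classical in
theorem exists_det_one_sub_sumZeroRep_eq [Nonempty α] :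
    ∃ c : ℂ, c ≠ 0 ∧ ∀ p : Perm α, LinearMap.det (1 - sumZeroRep p) =
      c * if p.IsCycleOn Set.univ then 1 else 0 := by
  by_cases h : ∃ q : Perm α, q.IsCycleOn Set.univ
  · obtain ⟨q, hq⟩ := h
    refine ⟨LinearMap.det (1 - sumZeroRep q), ?_, fun p => ?_⟩
    · rw [Ne, det_one_sub_sumZeroRep_eq_zero_iff]
      exact not_not.2 hq
    · split_ifs with hp
      · obtain ⟨g, rfl⟩ := isConj_iff.1 (isConj_of_isCycleOn_univ hq hp)
        have : 1 - sumZeroRep (g * q * g⁻¹) =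
            sumZeroRep g * (1 - sumZeroRep q) * sumZeroRep g⁻¹ := by
          have hg : sumZeroRep g * sumZeroRep g⁻¹ = 1 := by
            rw [← map_mul, mul_inv_cancel, map_one]
          rw [map_mul, map_mul]
          exact (one_sub_mul_mul_of_mul_eq_one (R := Module.End ℂ (sumZero α)) hg _)
        have hg : LinearMap.det (sumZeroRep g) * LinearMap.det (sumZeroRep g⁻¹) = 1 := by
          rw [← map_mul, ← map_mul, mul_inv_cancel, map_one, map_one]
        rw [this, map_mul, map_mul, mul_right_comm, hg, one_mul, mul_one]
      · rw [mul_zero]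
        exact (det_one_sub_sumZeroRep_eq_zero_iff p).2 hp
  -- This branch spares exhibiting a full cycle: without one, all the determinants vanish and any
  -- nonzero `c` works.
  · push Not at h
    exact ⟨1, one_ne_zero, fun p => by
      rw [if_neg (h p), mul_zero]; exact (det_one_sub_sumZeroRep_eq_zero_iff p).2 (h p)⟩

end

/-! ### Test vectors and their pairing -/

section
variable {α : Type*} [Fintype α] [DecidableEq α]

/-- The signed indicator of the permutations supported on `insert o S`. -/
def signedIndicator (o : α) (S : Finset α) (τ : Perm α) : ℂ :=
  if ∀ x, x ≠ o → x ∉ S → τ x = x then ((sign τ : ℤ) : ℂ) else 0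

/-- The indicator of the permutations fixing `S` pointwise. -/
def fixIndicator (S : Finset α) (ρ : Perm α) : ℂ :=
  if ∀ x ∈ S, ρ x = x then 1 else 0

theorem signedIndicator_mul_swap {o x : α} {S : Finset α} (ho : o ∉ S) (hx : x ∈ S)
    (τ : Perm α) : signedIndicator o S (τ * swap o x) = -signedIndicator o S τ := by
  have hox : o ≠ x := fun h => ho (h ▸ hx)
  have hiff : (∀ y, y ≠ o → y ∉ S → (τ * swap o x) y = y) ↔ ∀ y, y ≠ o → y ∉ S → τ y = y := by
    refine forall_congr' fun y => imp_congr_right fun hy => imp_congr_right fun hyS => ?_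
    rw [mul_apply, swap_apply_of_ne_of_ne hy (fun h => hyS (h ▸ hx))]
  rw [signedIndicator, signedIndicator]
  simp only [hiff]
  split_ifs <;> simp [sign_swap hox]

theorem signedIndicator_swap_mul {o x : α} {S : Finset α} (ho : o ∉ S) (hx : x ∈ S)
    (τ : Perm α) : signedIndicator o S (swap o x * τ) = -signedIndicator o S τ := by
  have hox : o ≠ x := fun h => ho (h ▸ hx)
  have hiff : (∀ y, y ≠ o → y ∉ S → (swap o x * τ) y = y) ↔ ∀ y, y ≠ o → y ∉ S → τ y = y := by
    refine forall_congr' fun y => imp_congr_right fun hy => imp_congr_right fun hyS => ?_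
    rw [mul_apply, ← (swap o x).injective.eq_iff, swap_apply_self,
      swap_apply_of_ne_of_ne hy (fun h => hyS (h ▸ hx))]
  rw [signedIndicator, signedIndicator]
  simp only [hiff]
  split_ifs <;> simp [sign_swap hox]

theorem fixIndicator_mul_swap {o x : α} {S : Finset α} (ho : o ∉ S) (hx : x ∉ S)
    (ρ : Perm α) : fixIndicator S (ρ * swap o x) = fixIndicator S ρ := by
  have hiff : (∀ y ∈ S, (ρ * swap o x) y = y) ↔ ∀ y ∈ S, ρ y = y := by
    refine forall_congr' fun y => imp_congr_right fun hy => ?_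
    rw [mul_apply, swap_apply_of_ne_of_ne (ne_of_mem_of_not_mem hy ho) (ne_of_mem_of_not_mem hy hx)]
  rw [fixIndicator, fixIndicator]
  simp only [hiff]

theorem fixIndicator_swap_mul {o x : α} {S : Finset α} (ho : o ∉ S) (hx : x ∉ S)
    (ρ : Perm α) : fixIndicator S (swap o x * ρ) = fixIndicator S ρ := by
  have hiff : (∀ y ∈ S, (swap o x * ρ) y = y) ↔ ∀ y ∈ S, ρ y = y := by
    refine forall_congr' fun y => imp_congr_right fun hy => ?_
    rw [mul_apply, ← (swap o x).injective.eq_iff, swap_apply_self,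
      swap_apply_of_ne_of_ne (ne_of_mem_of_not_mem hy ho) (ne_of_mem_of_not_mem hy hx)]
  rw [fixIndicator, fixIndicator]
  simp only [hiff]

omit [Fintype α] in
theorem exists_perm_fix_mem_iff [Finite α] {o : α} {S T : Finset α} (hS : o ∉ S) (hT : o ∉ T)
    (h : S.card = T.card) : ∃ g : Perm α, g o = o ∧ ∀ x, x ∈ S ↔ g x ∈ T := by
  have := Fintype.ofFinite α
  let e : {x // x ∈ S} ≃ {x // x ∈ T} := Finset.equivOfCardEq h
  let g := e.extendSubtype
  have hg : ∀ x, x ∈ S ↔ g x ∈ T := fun x =>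
    ⟨e.extendSubtype_mem x, fun hx => by
      by_contra hxS
      exact e.extendSubtype_not_mem x hxS hx⟩
  have hgo : g o ∉ T := fun h => hS ((hg o).2 h)
  -- Both `o` and `g o` lie outside `T`, so the swap sends `g o` back to `o` without disturbing `T`.
  refine ⟨swap o (g o) * g, by simp, fun x => ?_⟩
  rw [hg x, mul_apply]
  rcases eq_or_ne (g x) o with h1 | h1
  · rw [h1, swap_apply_left]; simp [hT, hgo]
  rcases eq_or_ne (g x) (g o) with h2 | h2
  · rw [h2, swap_apply_right]; simp [hT, hgo]
  · rw [swap_apply_of_ne_of_ne h1 h2]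

omit [Fintype α] [DecidableEq α] in
theorem isCycleOn_univ_mul_comm (p q : Perm α) :
    (p * q).IsCycleOn Set.univ ↔ (q * p).IsCycleOn Set.univ := by
  have key : ∀ p q : Perm α, (p * q).IsCycleOn Set.univ → (q * p).IsCycleOn Set.univ := by
    intro p q h
    have := h.conj (g := q)
    rwa [Set.image_univ, q.range_eq_univ, ← mul_assoc, mul_inv_cancel_right] at this
  exact ⟨key p q, key q p⟩

open Classical in
/-- The indicator of the permutations with a single cycle. -/
noncomputable def cycleIndicator (p : Perm α) : ℂ :=
  if p.IsCycleOn Set.univ then 1 else 0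

omit [Fintype α] [DecidableEq α] in
theorem cycleIndicator_mul_comm (p q : Perm α) :
    cycleIndicator (p * q) = cycleIndicator (q * p) := by
  classical
  exact if_congr (isCycleOn_univ_mul_comm p q) rfl rfl

/-- The value of the bilinear form with matrix `cycleIndicator (σ * π)` at the translates
of a signed indicator and a fixing indicator. -/
noncomputable def cyclePairing (o : α) (S S' : Finset α) (g g' : Perm α) : ℂ :=
  ∑ π : Perm α, ∑ σ : Perm α, signedIndicator o S (g⁻¹ * π) * cycleIndicator (σ * π) *
    fixIndicator S' (σ * g')

/-- For `x ∈ S \ S'` and `t = swap o x`, substituting `(π * t, t * σ)` for `(π, σ)` conjugates `σ *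
π` and flips only the signed factor, so the sum equals its negative. -/
theorem cyclePairing_eq_zero_of_not_subset {o : α} {S S' : Finset α} (hS : o ∉ S) (hS' : o ∉ S')
    (g g' : Perm α) (h : ¬ S ⊆ S') : cyclePairing o S S' g g' = 0 := by
  classical
  obtain ⟨x, hx, hx'⟩ := Finset.not_subset.1 h
  rw [← CharZero.eq_neg_self_iff (R := ℂ)]
  conv_lhs => rw [cyclePairing]
  rw [← _root_.Equiv.sum_comp (Equiv.mulRight (swap o x)), cyclePairing, ← Finset.sum_neg_distrib]
  refine Finset.sum_congr rfl fun π _ => ?_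
  rw [← _root_.Equiv.sum_comp (Equiv.mulLeft (swap o x)), ← Finset.sum_neg_distrib]
  refine Finset.sum_congr rfl fun σ _ => ?_
  simp only [coe_mulRight, coe_mulLeft]
  rw [← mul_assoc, signedIndicator_mul_swap hS hx, mul_assoc (swap o x) σ g',
    fixIndicator_swap_mul hS' hx', cycleIndicator_mul_comm (swap o x * σ),
    cycleIndicator_mul_comm σ π, mul_assoc π, swap_mul_self_mul]
  ring

/-- The same cancellation on the other side: with `t = swap o y`, `(t * π, σ * t)` leaves `σ * π`
unchanged. As `g` and `g'` fix `o`, they carry `t` to swaps of `o` with the preimages of `y`. -/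
theorem cyclePairing_eq_zero_of_not_image_subset {o : α} {S S' T T' : Finset α} (hS : o ∉ S)
    (hS' : o ∉ S') {g g' : Perm α} (hg : g o = o) (hg' : g' o = o) (hgT : ∀ x, x ∈ S ↔ g x ∈ T)
    (hgT' : ∀ x, x ∈ S' ↔ g' x ∈ T')
    (h : ¬ T ⊆ T') : cyclePairing o S S' g g' = 0 := by
  classical
  obtain ⟨y, hy, hy'⟩ := Finset.not_subset.1 h
  have hx : g⁻¹ y ∈ S := by rw [hgT]; simpa using hy
  have hx' : g'⁻¹ y ∉ S' := by rw [hgT']; simpa using hy'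
  have e1 : ∀ π, g⁻¹ * (swap o y * π) = swap o (g⁻¹ y) * (g⁻¹ * π) := fun π => by
    have := mul_swap_eq_swap_mul g⁻¹ o y
    rw [← mul_assoc, this, mul_assoc, Perm.inv_eq_iff_eq.2 hg.symm]
  have e2 : ∀ σ, σ * swap o y * g' = σ * g' * swap o (g'⁻¹ y) := fun σ => by
    have := swap_mul_eq_mul_swap g' o y
    rw [mul_assoc, this, mul_assoc, Perm.inv_eq_iff_eq.2 hg'.symm]
  rw [← CharZero.eq_neg_self_iff (R := ℂ)]
  conv_lhs => rw [cyclePairing]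
  rw [← _root_.Equiv.sum_comp (Equiv.mulLeft (swap o y)), cyclePairing, ← Finset.sum_neg_distrib]
  refine Finset.sum_congr rfl fun π _ => ?_
  rw [← _root_.Equiv.sum_comp (Equiv.mulRight (swap o y)), ← Finset.sum_neg_distrib]
  refine Finset.sum_congr rfl fun σ _ => ?_
  simp only [coe_mulRight, coe_mulLeft]
  rw [e1, e2, signedIndicator_swap_mul hS hx, fixIndicator_mul_swap hS' hx', mul_assoc σ,
    swap_mul_self_mul]
  ring

omit [DecidableEq α] in
theorem mem_of_isCycleOn_univ {p : Perm α} (hp : p.IsCycleOn Set.univ) {C : Set α}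
    (hC : ∀ x ∈ C, p x ∈ C) {x : α} (hx : x ∈ C) (y : α) : y ∈ C := by
  obtain ⟨k, rfl⟩ := (isCycleOn_univ_iff.1 hp x y).exists_nat_pow_eq
  induction k with
  | zero => exact hx
  | succ k ih => rw [pow_succ', mul_apply]; exact hC _ ih

omit [Fintype α] in
theorem sameCycle_of_mul_isCycleOn_univ [Finite α] {o : α} {S : Finset α} {τ ρ : Perm α}
    (hτ : ∀ x, x ≠ o → x ∉ S → τ x = x) (hρ : ∀ x ∈ S, ρ x = x)
    (h : (τ * ρ).IsCycleOn Set.univ) {x : α} (hx : x ∈ S) : τ.SameCycle o x := by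
  have := Fintype.ofFinite α
  -- This set contains `o` and is stable under `τ * ρ`, hence is everything.
  have key : x ∈ ({x | τ.SameCycle o x} ∪ {x | x ∉ S} : Set α) := by
    refine mem_of_isCycleOn_univ h ?_ (Or.inl (SameCycle.refl τ o)) x
    intro y hy
    by_cases hyS : y ∈ S
    · left
      have hy' : τ.SameCycle o y := hy.resolve_right (fun h => h hyS)
      simpa [mul_apply, hρ y hyS] using hy'
    · have hρy : ρ y ∉ S := fun h' => hyS (by
        rwa [← ρ.injective (hρ _ h')])
      rcases eq_or_ne (ρ y) o with h1 | h1
      · left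
        simp [mul_apply, h1, SameCycle.refl]
      · right
        rw [mul_apply, hτ _ h1 hρy]
        exact hρy
  exact key.resolve_right (fun h => h hx)

/-- A full-cycle product forces `τ` to be one cycle through `insert o S`. Its sign therefore depends
only on `S.card`, which rules out cancellation on the diagonal. -/
theorem sign_eq_of_mul_isCycleOn_univ {o : α} {S : Finset α} {τ ρ : Perm α}
    (ho : o ∉ S) (hτ : ∀ x, x ≠ o → x ∉ S → τ x = x) (hρ : ∀ x ∈ S, ρ x = x)
    (h : (τ * ρ).IsCycleOn Set.univ) : sign τ = (-1) ^ S.card := by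
  have hsc : ∀ x ∈ S, τ.SameCycle o x := fun x hx =>
    sameCycle_of_mul_isCycleOn_univ hτ hρ h hx
  rcases S.eq_empty_or_nonempty with rfl | ⟨s, hs⟩
  · have : τ = 1 := by
      have hne : ∀ x, x ≠ o → τ x = x := fun x hx => hτ x hx (by simp)
      ext x
      rcases eq_or_ne x o with rfl | hx
      · by_contra hc
        exact hc (τ.injective (hne _ hc))
      · exact hne x hx
    simp [this]
  · have hoo : τ o ≠ o := fun hc => ho (((hsc s hs).eq_of_left hc) ▸ hs)
    have hsupp : τ.support = insert o S := by
      ext x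
      rw [mem_support, Finset.mem_insert]
      constructor
      · intro hx
        by_contra! hc
        exact hx (hτ x hc.1 hc.2)
      · rintro (rfl | hx)
        · exact hoo
        · exact fun hc => hoo ((hsc x hx).apply_eq_self_iff.2 hc)
    have hcyc : τ.IsCycle := by
      refine ⟨o, hoo, fun y hy => ?_⟩
      rw [← mem_support, hsupp, Finset.mem_insert] at hy
      rcases hy with rfl | hy
      · exact SameCycle.refl _ _
      · exact hsc y hy
    rw [hcyc.sign, hsupp, Finset.card_insert_of_notMem ho, pow_succ]
    simp

/-- A cycle on `insert o S` and one on the complement of `S` meet only in `o`, so their product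
joins them into one cycle. -/
theorem exists_mul_isCycleOn_univ {o : α} {S : Finset α} (ho : o ∉ S) :
    ∃ τ ρ : Perm α, (∀ x, x ≠ o → x ∉ S → τ x = x) ∧ (∀ x ∈ S, ρ x = x) ∧
      (τ * ρ).IsCycleOn Set.univ := by
  obtain ⟨τ, hτ, hτs⟩ := (insert o S).exists_cycleOn
  obtain ⟨ρ, hρ, hρs⟩ := Sᶜ.exists_cycleOn
  have hτ' : ∀ x, x ≠ o → x ∉ S → τ x = x := by
    intro x hxo hx
    by_contra hc
    have := hτs (mem_support.2 hc)
    simp [hxo, hx] at this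
  have hρ' : ∀ x ∈ S, ρ x = x := by
    intro x hx
    by_contra hc
    have := hρs (mem_support.2 hc)
    simp [hx] at this
  have hρS : ∀ x, x ∉ S → ρ x ∉ S := fun x hx h' => hx (by
    rwa [← ρ.injective (hρ' _ h')])
  refine ⟨τ, ρ, hτ', hρ', ?_⟩
  have hρo : ∀ k : ℕ, (ρ ^ k) o ∉ S ∧ (τ * ρ).SameCycle o ((ρ ^ k) o) := by
    intro k
    induction k with
    | zero => exact ⟨ho, SameCycle.refl _ _⟩
    | succ k ih =>
      rw [pow_succ', mul_apply]
      refine ⟨hρS _ ih.1, ?_⟩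
      rcases eq_or_ne (ρ ((ρ ^ k) o)) o with h1 | h1
      · rw [h1]
      · have := sameCycle_apply_right.2 ih.2
        rwa [mul_apply, hτ' _ h1 (hρS _ ih.1)] at this
  have hinS : ∀ x, x ∉ S → (τ * ρ).SameCycle o x := by
    intro x hx
    obtain ⟨k, rfl⟩ := (hρ.2 (by simpa using ho : o ∈ (↑(Sᶜ) : Set α))
      (by simpa using hx : x ∈ (↑(Sᶜ) : Set α))).exists_nat_pow_eq
    exact (hρo k).2
  have hτo : ∀ k : ℕ, (τ * ρ).SameCycle o ((τ ^ k) o) := by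
    intro k
    induction k with
    | zero => exact SameCycle.refl _ _
    | succ k ih =>
      rw [pow_succ', mul_apply]
      generalize (τ ^ k) o = y at ih
      by_cases hy : y ∈ S
      · have := sameCycle_apply_right.2 ih
        rwa [mul_apply, hρ' y hy] at this
      · rcases eq_or_ne y o with rfl | hyo
        · obtain ⟨w, hw⟩ := ρ.surjective y
          have h1 : w ∉ S := fun h' => ho (by rwa [← hw, hρ' w h'])
          have := sameCycle_apply_right.2 (hinS w h1)
          rwa [mul_apply, hw] at this
        · rwa [hτ' y hyo hy]
  have hall : ∀ x, (τ * ρ).SameCycle o x := by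
    intro x
    by_cases hx : x ∈ S
    · obtain ⟨k, rfl⟩ := (hτ.2 (by simp : o ∈ (↑(insert o S) : Set α))
        (by simp [hx] : x ∈ (↑(insert o S) : Set α))).exists_nat_pow_eq
      exact hτo k
    · exact hinS x hx
  rw [isCycleOn_univ_iff]
  exact fun x y => (hall x).symm.trans (hall y)

theorem cyclePairing_self_ne_zero {o : α} {S : Finset α} (ho : o ∉ S) (g : Perm α) :
    cyclePairing o S S g g ≠ 0 := by
  classical
  have h1 : cyclePairing o S S g g = (-1) ^ S.card * ((∑ τ : Perm α, ∑ ρ : Perm α,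
      if (∀ x, x ≠ o → x ∉ S → τ x = x) ∧ (∀ x ∈ S, ρ x = x) ∧ (τ * ρ).IsCycleOn Set.univ
      then 1 else 0 : ℕ) : ℂ) := by
    rw [cyclePairing, ← _root_.Equiv.sum_comp (Equiv.mulLeft g)]
    push_cast
    rw [Finset.mul_sum]
    refine Finset.sum_congr rfl fun τ _ => ?_
    rw [← _root_.Equiv.sum_comp (Equiv.mulRight g⁻¹), Finset.mul_sum]
    refine Finset.sum_congr rfl fun ρ _ => ?_
    simp only [coe_mulRight, coe_mulLeft, inv_mul_cancel_left, inv_mul_cancel_right]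
    have hc : ρ * g⁻¹ * (g * τ) = ρ * τ := by group
    rw [hc, cycleIndicator_mul_comm ρ τ, cycleIndicator, signedIndicator, fixIndicator]
    by_cases a : ∀ x, x ≠ o → x ∉ S → τ x = x
    · by_cases b : ∀ x ∈ S, ρ x = x
      · by_cases c : (τ * ρ).IsCycleOn Set.univ
        · rw [if_pos a, if_pos b, if_pos c, if_pos ⟨a, b, c⟩,
            sign_eq_of_mul_isCycleOn_univ ho a b c]
          simp
        · simp [c]
      · simp [b]
    · rw [if_neg a, if_neg (fun h : _ ∧ _ => a h.1)]
      simp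
  rw [h1]
  refine mul_ne_zero (pow_ne_zero _ (by norm_num)) (Nat.cast_ne_zero.2 ?_)
  obtain ⟨τ, ρ, h⟩ := exists_mul_isCycleOn_univ ho
  intro h0
  have h2 := (Finset.sum_eq_zero_iff.1 h0) τ (Finset.mem_univ _)
  have h3 := (Finset.sum_eq_zero_iff.1 h2) ρ (Finset.mem_univ _)
  rw [if_pos h] at h3
  exact one_ne_zero h3

end

/-- Pairs of subsets of `Fin d` of the same size. -/
abbrev EquicardPair (d : ℕ) : Type :=
  (S : Finset (Fin d)) × {T : Finset (Fin d) // T.card = S.card}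

/-! ### The two rank bounds -/

theorem card_equicardPair (d : ℕ) : Fintype.card (EquicardPair d) = (2 * d).choose d := by
  rw [Fintype.card_sigma, ← sum_finset_choose_card]
  simp

theorem choose_le_rank_cycleIndicator (d : ℕ) :
    (2 * d).choose d ≤
      (Matrix.of fun π σ : Perm (Fin (d + 1)) => cycleIndicator (σ * π)).rank := by
  have h0 : ∀ S : Finset (Fin d), (0 : Fin (d + 1)) ∉ S.map (Fin.succEmb d) := by simp
  have hex : ∀ i : EquicardPair d, ∃ g : Perm (Fin (d + 1)), g 0 = 0 ∧
      ∀ x, x ∈ i.1.map (Fin.succEmb d) ↔ g x ∈ i.2.1.map (Fin.succEmb d) := fun i =>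
    exists_perm_fix_mem_iff (h0 _) (h0 _) (by simp [i.2.2])
  choose g hg0 hg using hex
  let X : Matrix (EquicardPair d) (Perm (Fin (d + 1))) ℂ := Matrix.of fun i π =>
    signedIndicator 0 (i.1.map (Fin.succEmb d)) ((g i)⁻¹ * π)
  let Y : Matrix (Perm (Fin (d + 1))) (EquicardPair d) ℂ := Matrix.of fun σ j =>
    fixIndicator (j.1.map (Fin.succEmb d)) (σ * g j)
  set M : Matrix (Perm (Fin (d + 1))) (Perm (Fin (d + 1))) ℂ :=
    Matrix.of fun π σ => cycleIndicator (σ * π) with hM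
  have hB : ∀ i j, (X * (M * Y)) i j =
      cyclePairing 0 (i.1.map (Fin.succEmb d)) (j.1.map (Fin.succEmb d)) (g i) (g j) := by
    intro i j
    simp only [Matrix.mul_apply, cyclePairing, X, Y, hM, Matrix.of_apply, Finset.mul_sum,
      mul_assoc]
  have hsub : ∀ i j, (X * (M * Y)) i j ≠ 0 → i.1 ⊆ j.1 ∧ i.2.1 ⊆ j.2.1 := by
    intro i j hij
    rw [hB] at hij
    constructor
    · by_contra hc
      exact hij (cyclePairing_eq_zero_of_not_subset (h0 _) (h0 _) _ _ (by simpa using hc))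
    · by_contra hc
      exact hij (cyclePairing_eq_zero_of_not_image_subset (h0 _) (h0 _) (hg0 i) (hg0 j)
        (hg i) (hg j) (by simpa using hc))
  have hdet : (X * (M * Y)).det ≠ 0 := by
    intro hz
    obtain ⟨v, hv, hmul⟩ := Matrix.exists_mulVec_eq_zero_iff.2 hz
    have hne : (Finset.univ.filter fun i => v i ≠ 0).Nonempty := by
      obtain ⟨i, hi⟩ := Function.ne_iff.1 hv
      exact ⟨i, by simpa using hi⟩
    -- Row `i` involves only pairs containing `i`; by maximality of its size in the support of `v`,
    -- only the diagonal term survives.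
    obtain ⟨i, hi, hmax⟩ := Finset.exists_max_image _ (fun i : EquicardPair d => i.1.card) hne
    have hi' : v i ≠ 0 := by simpa using hi
    have hrow := congrFun hmul i
    rw [Matrix.mulVec, dotProduct, Finset.sum_eq_single i] at hrow
    · refine mul_ne_zero ?_ hi' hrow
      rw [hB]
      exact cyclePairing_self_ne_zero (h0 _) _
    · intro j _ hji
      by_contra hc
      obtain ⟨hBij, hvj⟩ := mul_ne_zero_iff.1 hc
      obtain ⟨hs1, hs2⟩ := hsub i j hBij
      have hle := hmax j (by simpa using hvj)
      have e1 : i.1 = j.1 := Finset.eq_of_subset_of_card_le hs1 hle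
      have e2 : i.2.1 = j.2.1 := Finset.eq_of_subset_of_card_le hs2 (by
        rw [i.2.2, j.2.2]; exact hle)
      obtain ⟨S, T, hT⟩ := i
      obtain ⟨S', T', hT'⟩ := j
      obtain rfl : S = S' := e1
      obtain rfl : T = T' := e2
      exact hji rfl
    · simp
  rw [← card_equicardPair, ← Matrix.rank_of_det_ne_zero hdet]
  exact (Matrix.rank_mul_le_right _ _).trans (Matrix.rank_mul_le_left _ _)

/-- Since `1 - ρ (σ * π⁻¹) = (ρ π - ρ σ) * ρ π⁻¹`, passing to `det (ρ π - ρ σ)` only rescales the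
row of `π`. -/
theorem rank_cycleIndicator_mul_inv_le {α : Type*} [Fintype α] [DecidableEq α] [Nonempty α] :
    (Matrix.of fun π σ : Perm α => cycleIndicator (σ * π⁻¹)).rank ≤
      (2 * (Fintype.card α - 1)).choose (Fintype.card α - 1) := by
  classical
  obtain ⟨c, hc, hdet⟩ := exists_det_one_sub_sumZeroRep_eq (α := α)
  let b := Module.finBasisOfFinrankEq ℂ (sumZero α) finrank_sumZero
  let A : Perm α → Matrix (Fin (Fintype.card α - 1)) (Fin (Fintype.card α - 1)) ℂ :=
    fun p => LinearMap.toMatrix b b (sumZeroRep p)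
  have hentry : ∀ π σ : Perm α, cycleIndicator (σ * π⁻¹) =
      c⁻¹ * LinearMap.det (sumZeroRep π⁻¹) * (A π - A σ).det := by
    intro π σ
    have h1 : (A π - A σ).det = LinearMap.det (sumZeroRep π - sumZeroRep σ) := by
      rw [← LinearMap.det_toMatrix b]
      exact congrArg Matrix.det (map_sub (LinearMap.toMatrix b b) _ _).symm
    have h2 : LinearMap.det (sumZeroRep π - sumZeroRep σ) * LinearMap.det (sumZeroRep π⁻¹) =
        LinearMap.det (1 - sumZeroRep (σ * π⁻¹)) := by
      rw [← map_mul]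
      congr 1
      have h3 : sumZeroRep π * sumZeroRep π⁻¹ = 1 := by
        rw [← map_mul, mul_inv_cancel, map_one]
      rw [map_mul, ← h3]
      exact sub_mul (α := Module.End ℂ (sumZero α)) _ _ _
    rw [h1, mul_assoc, mul_comm (LinearMap.det _), h2, hdet, inv_mul_cancel_left₀ hc]
    rfl
  have hmat : (Matrix.of fun π σ : Perm α => cycleIndicator (σ * π⁻¹)) =
      Matrix.diagonal (fun π : Perm α => c⁻¹ * LinearMap.det (sumZeroRep π⁻¹)) *
        Matrix.of fun π σ : Perm α => (A π - A σ).det := by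
    ext π σ
    rw [Matrix.diagonal_mul, Matrix.of_apply, Matrix.of_apply, hentry]
  rw [hmat]
  exact (Matrix.rank_mul_le_right _ _).trans (Matrix.rank_det_sub_le A A)

theorem rank_matrixQ_eq_rank_matrixP (n : ℕ) : (matrixQ n).rank = (matrixP n).rank := by
  have h : matrixQ n = (matrixP n).submatrix (Equiv.inv (Perm (Fin n))) (Equiv.refl _) := rfl
  rw [h, Matrix.rank_submatrix]

theorem theorem1 (n : ℕ) (hn : 1 ≤ n) :
    (matrixQ n).rank = Nat.choose (2 * n - 2) (n - 1) ∧
      (matrixP n).rank = Nat.choose (2 * n - 2) (n - 1) := by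
  obtain ⟨d, rfl⟩ : ∃ d, n = d + 1 := ⟨n - 1, by omega⟩
  have hle : (matrixQ (d + 1)).rank ≤ (2 * d).choose d := by
    have h := rank_cycleIndicator_mul_inv_le (α := Fin (d + 1))
    rw [Fintype.card_fin, Nat.add_sub_cancel] at h
    exact h
  have hge : (2 * d).choose d ≤ (matrixP (d + 1)).rank := choose_le_rank_cycleIndicator d
  have heq := rank_matrixQ_eq_rank_matrixP (d + 1)
  have h2 : 2 * (d + 1) - 2 = 2 * d := by omega
  rw [h2, Nat.add_sub_cancel]
  omega
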